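/- Let $\gamma$ be the standard Gaussian measure on the latent space $\mathbb{R}^d$. Let $\mu^\star$ be a probability measure on $\mathbb{R}^D$ whose support is disconnected and composed of $m\ge 2$ modes, $S_{\mu^\star}=M_1\cup\dots\cup M_m$, where the $M_i$ are non-empty, closed and pairwise disjoint (for instance closed submanifolds). For $L>0$ put $$\varepsilon_{\min}=\min_{i\ne j}\frac{\|M_i-M_j\|}{L},\qquad \|M_i-M_j\|=\inf_{x\in M_i,\,y\in M_j}\|x-y\|.$$ A map $G:\mathbb{R}^d\to\mathbb{R}^D$ is called well-balanced if there is a measurable partition $A_1,\dots,A_m$ of $\mathbb{R}^d$ (up to $\gamma$-null sets) with $\gamma(A_1)=\dots=\gamma(A_m)=1/m$ such that for every $i$ and every $z\in A_i$ the mode $M_i$ is a closest one to $G(z)$, that is, $\operatorname{dist}(G(z),M_i)=\min_j \operatorname{dist}(G(z),M_j)$. Let $\nu$ be either $\mu^\star$ itself or the empirical measure $\mu_n$ of points $X_1,\dots,X_n\in S_{\mu^\star}$, $n\ge1$. The precision and the recall of $G$ are $\alpha_G=(G\sharp\gamma)(S_\nu)$ and $\beta_G=\nu(S_{G\sharp\gamma})$,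 where $S_\rho$ denotes the support of the measure $\rho$. Assume that $L\ge d\sqrt{\log m}$. Then every well-balanced $L$-Lipschitz map $G:\mathbb{R}^d\to\mathbb{R}^D$ with recall $\beta_G=1$ satisfies $$\alpha_G\;\le\;1-\frac{\varepsilon_{\min}\,\bigl(1-\varepsilon_{\min}\sqrt{2\log m}\bigr)}{\sqrt{2\pi}}.$$ Moreover the upper bound on the precision decreases like $\sqrt{\log m}$: there is a universal constant $c>0$ (independent of $d$, $D$, $m$, $L$, $\mu^\star$, $\nu$ and $G$) such that every such $G$ satisfies $$\alpha_G\;\le\;1-c\,\min\bigl(1,\ \varepsilon_{\min}\sqrt{\log m}\bigr).$$ -/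

import Mathlib

open MeasureTheory ProbabilityTheory
open scoped NNReal ENNReal

/-- The distance between two sets, `inf {‖x - y‖ : x ∈ A, y ∈ B}`
(meaningful for non-empty `A` and `B`). -/
noncomputable def setDist {D : ℕ} (A B : Set (EuclideanSpace ℝ (Fin D))) : ℝ :=
  ⨅ p : A × B, dist (p.1 : EuclideanSpace ℝ (Fin D)) p.2

/-- The support of the distribution `μ` is disconnected and composed of the `m ≥ 2` modes
`M 0, …, M (m - 1)`: these are non-empty, closed, pairwise disjoint, and their union is the
support of `μ`. Nothing else is asked of a mode, so that closed submanifolds of any dimension,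
with or without boundary, and single points are all allowed. -/
structure HasDisconnectedModes {D m : ℕ} (μ : Measure (EuclideanSpace ℝ (Fin D)))
    (M : Fin m → Set (EuclideanSpace ℝ (Fin D))) : Prop where
  two_le : 2 ≤ m
  nonempty : ∀ i, (M i).Nonempty
  isClosed : ∀ i, IsClosed (M i)
  disjoint : ∀ i j, i ≠ j → Disjoint (M i) (M j)
  support_eq : μ.support = ⋃ i, M i

/-- A measurable partition of the latent space `ℝ^d`, up to sets of Gaussian measure zero. Every
measurable set-theoretic partition is one; so are cells that share their boundaries, and open
cells that leave out a null set. -/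
structure IsGaussianPartition {d m : ℕ} (A : Fin m → Set (EuclideanSpace ℝ (Fin d))) : Prop where
  measurableSet : ∀ i, MeasurableSet (A i)
  inter_null : ∀ i j, i ≠ j → stdGaussian (EuclideanSpace ℝ (Fin d)) (A i ∩ A j) = 0
  cover : ∀ᵐ z ∂(stdGaussian (EuclideanSpace ℝ (Fin d))), z ∈ ⋃ i, A i

/-- The generator `G` is associated with the cells `A`: on `A i`, the mode `M i` is a closest one
to `G z`. A tie may be broken in favour of any closest mode. -/
def IsAssociated {d D m : ℕ} (M : Fin m → Set (EuclideanSpace ℝ (Fin D)))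
    (A : Fin m → Set (EuclideanSpace ℝ (Fin d)))
    (G : EuclideanSpace ℝ (Fin d) → EuclideanSpace ℝ (Fin D)) : Prop :=
  ∀ i, ∀ z ∈ A i, ∀ j, Metric.infDist (G z) (M i) ≤ Metric.infDist (G z) (M j)

/-- The generator `G` is well-balanced: it is associated with a partition of the latent space into
cells of the same Gaussian measure `1 / m`. -/
def IsWellBalanced {d D m : ℕ} (M : Fin m → Set (EuclideanSpace ℝ (Fin D)))
    (G : EuclideanSpace ℝ (Fin d) → EuclideanSpace ℝ (Fin D)) : Prop :=
  ∃ A : Fin m → Set (EuclideanSpace ℝ (Fin d)), IsGaussianPartition A ∧ IsAssociated M A G ∧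
    ∀ i, (stdGaussian (EuclideanSpace ℝ (Fin d))).real (A i) = 1 / (m : ℝ)

/-- The empirical measure of the points `X 0, …, X (n - 1)`. -/
noncomputable def empiricalMeasure {D n : ℕ} (X : Fin n → EuclideanSpace ℝ (Fin D)) :
    Measure (EuclideanSpace ℝ (Fin D)) :=
  (n : ℝ≥0∞)⁻¹ • ∑ k, Measure.dirac (X k)

/-- The (maximum attainable) precision of `G` with respect to `ν`: the mass that the pushforward
of the standard Gaussian under `G` gives to the support of `ν`. -/
noncomputable def genPrecision {d D : ℕ} (ν : Measure (EuclideanSpace ℝ (Fin D)))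
    (G : EuclideanSpace ℝ (Fin d) → EuclideanSpace ℝ (Fin D)) : ℝ :=
  ((stdGaussian (EuclideanSpace ℝ (Fin d))).map G).real ν.support

/-- The (maximum attainable) recall of `G` with respect to `ν`: the mass that `ν` gives to the
support of the pushforward of the standard Gaussian under `G`. -/
noncomputable def genRecall {d D : ℕ} (ν : Measure (EuclideanSpace ℝ (Fin D)))
    (G : EuclideanSpace ℝ (Fin d) → EuclideanSpace ℝ (Fin D)) : ℝ :=
  ν.real ((stdGaussian (EuclideanSpace ℝ (Fin d))).map G).support

/-- `ε_min`, the least distance between two different modes, divided by `L`. -/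
noncomputable def epsMin {D m : ℕ} (M : Fin m → Set (EuclideanSpace ℝ (Fin D))) (L : ℝ) : ℝ :=
  ⨅ p : {p : Fin m × Fin m // p.1 ≠ p.2}, setDist (M p.1.1) (M p.1.2) / L

/-! Each mode `M i` gets a bump `f i z = max 0 (1 - dist (G z, M i) / r)` with `r = ε L / 2` and `ε
= epsMin M L > 0`. It is `2 / ε`-Lipschitz, equals `1` where `G` lands in `M i`, and is positive
only where `G z` is closer than `r` to `M i`. Points of different modes are at least `2 r` apart, so
this last set lies in the cell `A i` up to a null set and has mass at most `1 / m`. The precision is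
at most `a = ∑ i, γ {f i = 1}`, so it remains to show that the transition regions `{0 < f i < 1}`
carry enough mass: an isoperimetric statement for many small cells.

Compare a Gaussian vector `X` with its rotation `X_θ = cos θ X + sin θ Y`, where `Y` is an
independent copy. From above, `𝔼 |f X - f X_θ|` is at most `θ √(2 / π)` times the mean of `‖∇f‖`
(`rotationOscillation_le`), and `∇f` lives on the transition region (`integral_norm_fderiv_le`).
From below, it is at least `2 γ {f = 1}` minus twice the noise stability of `{f > 0}`
(`sub_noiseStability_le_rotationOscillation`). If that stability is at most half the mass of the
set, summing over the cells gives `2 a - 1 ≤ θ √(2 / π) (2 / ε) (1 - a)`.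

At `θ = π / 2` the two vectors are independent and `m ≥ 2` suffices; this gives the explicit bound.
A set of mass `1 / m` already loses half of itself at an angle of order `1 / √(log m)`, by the
small-set estimate `noiseStability_le_half`; this gives the rate. -/

/-! ### Linear combinations of independent Gaussian vectors. -/

/-- The continuous linear map sending `x : ι → E` to the family of linear combinations of the
`x j` whose coefficients are the rows of `A`. -/
noncomputable def linComb {ι κ : Type*} [Fintype ι] (E : Type*) [NormedAddCommGroup E]
    [NormedSpace ℝ E] (A : Matrix κ ι ℝ) : (ι → E) →L[ℝ] (κ → E) :=
  ContinuousLinearMap.pi fun i => ∑ j, A i j • ContinuousLinearMap.proj j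

lemma linComb_apply {ι κ E : Type*} [Fintype ι] [NormedAddCommGroup E]
    [NormedSpace ℝ E] (A : Matrix κ ι ℝ) (x : ι → E) (i : κ) :
    linComb E A x i = ∑ j, A i j • x j := by
  simp [linComb]

section Gaussian

variable {E : Type*} [NormedAddCommGroup E] [InnerProductSpace ℝ E] [FiniteDimensional ℝ E]
  [MeasurableSpace E] [BorelSpace E]

/-- By independence the characteristic function is a product over `j` of Gaussian factors, whose
exponents are squared dual norms. Expanding these norms in an orthonormal basis and summing over `j`
leaves the coefficients only in the form `A * Aᵀ`. -/
lemma charFunDual_map_linComb {ι κ : Type*} [Fintype ι] [Fintype κ] [DecidableEq ι]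
    [DecidableEq κ] (A : Matrix κ ι ℝ) (L : StrongDual ℝ (κ → E)) :
    charFunDual ((Measure.pi fun _ : ι => stdGaussian E).map (linComb E A)) L =
      Complex.exp (-((∑ e, ∑ i, ∑ i', (A * A.transpose) i i' *
        (L (Pi.single i (stdOrthonormalBasis ℝ E e)) *
          L (Pi.single i' (stdOrthonormalBasis ℝ E e))) : ℝ) : ℂ) / 2) := by
  rw [charFunDual_map, charFunDual_pi]
  simp_rw [charFunDual_stdGaussian]
  rw [← Complex.exp_sum]
  congr 1
  rw [← Finset.sum_div, Finset.sum_neg_distrib]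
  congr 2
  simp_rw [← Complex.ofReal_pow]
  rw [← Complex.ofReal_sum]
  congr 1
  have key : ∀ (j : ι) (e : E), L (linComb E A (Pi.single j e)) =
      ∑ i, A i j * L (Pi.single i e) := by
    intro j e
    have : linComb E A (Pi.single j e) = ∑ i, A i j • (Pi.single i e : κ → E) := by
      ext1 i
      rw [linComb_apply, Finset.sum_apply]
      rw [Finset.sum_eq_single j, Finset.sum_eq_single i]
      · simp
      · intro b _ hb; simp [hb.symm]
      · simp
      · intro b _ hb; simp [hb]
      · simp
    rw [this, map_sum]
    simp
  simp_rw [(stdOrthonormalBasis ℝ E).norm_dual]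
  rw [Finset.sum_comm]
  refine Finset.sum_congr rfl fun e _ => ?_
  have : ∀ j : ι, (L.comp (linComb E A)).comp (ContinuousLinearMap.single ℝ (fun _ : ι => E) j)
      (stdOrthonormalBasis ℝ E e) ^ 2 = ∑ i, ∑ i', A i j * A i' j *
        (L (Pi.single i (stdOrthonormalBasis ℝ E e)) *
          L (Pi.single i' (stdOrthonormalBasis ℝ E e))) := by
    intro j
    change (L (linComb E A (Pi.single j _))) ^ 2 = _
    rw [key, sq, Finset.sum_mul_sum]
    refine Finset.sum_congr rfl fun i _ => Finset.sum_congr rfl fun i' _ => by ring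
  refine (Finset.sum_congr rfl fun j _ => this j).trans ?_
  rw [Finset.sum_comm]
  refine Finset.sum_congr rfl fun i _ => ?_
  rw [Finset.sum_comm]
  refine Finset.sum_congr rfl fun i' _ => ?_
  rw [Matrix.mul_apply, Finset.sum_mul]
  rfl

/-- The joint law of linear combinations of independent standard Gaussian vectors depends on the
coefficients only through their Gram matrix. -/
lemma map_linComb_eq_of_gram_eq {ι ι' κ : Type*} [Fintype ι] [Fintype ι'] [Fintype κ]
    [DecidableEq ι] [DecidableEq ι'] [DecidableEq κ] (A : Matrix κ ι ℝ) (B : Matrix κ ι' ℝ)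
    (h : A * A.transpose = B * B.transpose) :
    (Measure.pi fun _ : ι => stdGaussian E).map (linComb E A) =
      (Measure.pi fun _ : ι' => stdGaussian E).map (linComb E B) := by
  have := Measure.isProbabilityMeasure_map (μ := Measure.pi fun _ : ι => stdGaussian E)
    (linComb E A).continuous.aemeasurable
  have := Measure.isProbabilityMeasure_map (μ := Measure.pi fun _ : ι' => stdGaussian E)
    (linComb E B).continuous.aemeasurable
  apply Measure.ext_of_charFunDual
  ext L
  rw [charFunDual_map_linComb, charFunDual_map_linComb, h]

/-- Integrals of functions of linear combinations of independent standard Gaussian vectors depend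
on the coefficients only through their Gram matrix. -/
lemma integral_linComb_eq_of_gram_eq {ι ι' κ : Type*} [Fintype ι] [Fintype ι'] [Fintype κ]
    [DecidableEq ι] [DecidableEq ι'] [DecidableEq κ] (A : Matrix κ ι ℝ) (B : Matrix κ ι' ℝ)
    (h : A * A.transpose = B * B.transpose) {F : (κ → E) → ℝ} (hF : Measurable F) :
    ∫ x, F (linComb E A x) ∂(Measure.pi fun _ : ι => stdGaussian E) =
      ∫ x, F (linComb E B x) ∂(Measure.pi fun _ : ι' => stdGaussian E) := by
  rw [← integral_map (linComb E A).continuous.aemeasurable hF.aestronglyMeasurable,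
    map_linComb_eq_of_gram_eq A B h,
    integral_map (linComb E B).continuous.aemeasurable hF.aestronglyMeasurable]

lemma integral_pi_two (F : E × E → ℝ) :
    ∫ x : Fin 2 → E, F (x 0, x 1) ∂(Measure.pi fun _ => stdGaussian E) =
      ∫ p, F p ∂((stdGaussian E).prod (stdGaussian E)) :=
  (measurePreserving_finTwoArrow (stdGaussian E)).integral_comp' F

lemma integral_pi_succ (n : ℕ) (F : E × (Fin n → E) → ℝ) :
    ∫ x : Fin (n + 1) → E, F (x 0, fun i => x i.succ) ∂(Measure.pi fun _ => stdGaussian E) =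
      ∫ p, F p ∂((stdGaussian E).prod (Measure.pi fun _ : Fin n => stdGaussian E)) :=
  (measurePreserving_piFinSuccAbove (fun _ : Fin (n + 1) => stdGaussian E) 0).integral_comp' F

/-- Rotation invariance of a pair of independent standard Gaussian vectors. -/
lemma integral_rotation {c s : ℝ} (h : c ^ 2 + s ^ 2 = 1) {F : E × E → ℝ} (hF : Measurable F) :
    ∫ p, F (c • p.1 + s • p.2, -s • p.1 + c • p.2) ∂((stdGaussian E).prod (stdGaussian E)) =
      ∫ p, F p ∂((stdGaussian E).prod (stdGaussian E)) := by
  have := integral_linComb_eq_of_gram_eq (E := E) !![c, s; -s, c] (1 : Matrix (Fin 2) (Fin 2) ℝ)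
    (by
      rw [Matrix.one_mul, Matrix.transpose_one]
      ext i j
      fin_cases i <;> fin_cases j <;>
        simp [Matrix.mul_apply, Fin.sum_univ_two] <;> linarith)
    (F := fun w => F (w 0, w 1)) (by fun_prop)
  simp only [linComb_apply, Fin.sum_univ_two] at this
  simp at this
  rw [← integral_pi_two (fun p => F (c • p.1 + s • p.2, -s • p.1 + c • p.2)), ← integral_pi_two F]
  simpa using this

end Gaussian

/-! ### Integrals of functions with values in the unit interval. -/

/-- The Cauchy–Schwarz inequality for real integrals. -/
lemma sq_integral_mul_le {α : Type*} [MeasurableSpace α] {μ : Measure α} {u v : α → ℝ}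
    (hu : Integrable (fun x => u x ^ 2) μ) (hv : Integrable (fun x => v x ^ 2) μ)
    (huv : Integrable (fun x => u x * v x) μ) :
    (∫ x, u x * v x ∂μ) ^ 2 ≤ (∫ x, u x ^ 2 ∂μ) * ∫ x, v x ^ 2 ∂μ := by
  have h : ∀ t : ℝ, 0 ≤ (∫ x, u x ^ 2 ∂μ) * (t * t) + (2 * ∫ x, u x * v x ∂μ) * t +
      ∫ x, v x ^ 2 ∂μ := by
    intro t
    have h0 : 0 ≤ ∫ x, (t * u x + v x) ^ 2 ∂μ := integral_nonneg fun x => sq_nonneg _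
    have h1 : ∫ x, (t * u x + v x) ^ 2 ∂μ =
        ∫ x, (t * t) * u x ^ 2 + (2 * t) * (u x * v x) + v x ^ 2 ∂μ :=
      integral_congr_ae (Filter.Eventually.of_forall fun x => by ring)
    have hi : Integrable (fun x => (t * t) * u x ^ 2 + (2 * t) * (u x * v x)) μ :=
      (hu.const_mul _).add (huv.const_mul _)
    rw [h1, integral_add hi hv,
      integral_add (hu.const_mul _) (huv.const_mul _), integral_const_mul,
      integral_const_mul] at h0
    linarith
  have := discrim_le_zero h
  rw [discrim] at this
  linarith

lemma integrable_of_mem_unitInterval {α : Type*} [MeasurableSpace α] {μ : Measure α}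
    [IsFiniteMeasure μ] {u : α → ℝ} (hu : Measurable u) (h : ∀ x, u x ∈ Set.Icc (0 : ℝ) 1) :
    Integrable u μ :=
  Integrable.of_bound hu.aestronglyMeasurable 1 (Filter.Eventually.of_forall fun x => by
    rw [Real.norm_eq_abs, abs_of_nonneg (h x).1]; exact (h x).2)

lemma integral_mem_unitInterval {α : Type*} [MeasurableSpace α] {μ : Measure α}
    [IsProbabilityMeasure μ] {u : α → ℝ} (hu : Measurable u) (h : ∀ x, u x ∈ Set.Icc (0 : ℝ) 1) :
    ∫ x, u x ∂μ ∈ Set.Icc (0 : ℝ) 1 := by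
  refine ⟨integral_nonneg fun x => (h x).1, ?_⟩
  calc ∫ x, u x ∂μ ≤ ∫ _, (1 : ℝ) ∂μ :=
        integral_mono (integrable_of_mem_unitInterval hu h) (integrable_const _) fun x => (h x).2
    _ = 1 := by simp

lemma sq_le_self_of_mem_unitInterval {t : ℝ} (h : t ∈ Set.Icc (0 : ℝ) 1) : t ^ 2 ≤ t := by
  nlinarith [h.1, h.2]

lemma pow_mem_unitInterval {t : ℝ} (h : t ∈ Set.Icc (0 : ℝ) 1) (k : ℕ) :
    t ^ k ∈ Set.Icc (0 : ℝ) 1 :=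
  ⟨pow_nonneg h.1 _, pow_le_one₀ h.1 h.2⟩

lemma mul_mem_unitInterval {s t : ℝ} (hs : s ∈ Set.Icc (0 : ℝ) 1) (ht : t ∈ Set.Icc (0 : ℝ) 1) :
    s * t ∈ Set.Icc (0 : ℝ) 1 :=
  ⟨mul_nonneg hs.1 ht.1, mul_le_one₀ hs.2 ht.1 ht.2⟩

/-! ### Noise operator and small-set noise stability. -/

section Gaussian

variable {E : Type*} [NormedAddCommGroup E] [InnerProductSpace ℝ E] [FiniteDimensional ℝ E]
  [MeasurableSpace E] [BorelSpace E]

/-- The noise operator `f ↦ (z ↦ 𝔼 f (a z + b Y))` with `Y` a standard Gaussian vector. -/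
noncomputable def gaussianNoise (f : E → ℝ) (a b : ℝ) (z : E) : ℝ :=
  ∫ y, f (a • z + b • y) ∂(stdGaussian E)

/-- The noise stability `𝔼 f (X) f (ρ X + σ Y)` with `X`, `Y` independent standard Gaussian
vectors. -/
noncomputable def noiseStability (f : E → ℝ) (ρ σ : ℝ) : ℝ :=
  ∫ p, f p.1 * f (ρ • p.1 + σ • p.2) ∂((stdGaussian E).prod (stdGaussian E))

variable {f : E → ℝ}

lemma measurable_gaussianNoise (hf : Measurable f) (a b : ℝ) :
    Measurable (gaussianNoise f a b) := by
  have : Measurable fun p : E × E => f (a • p.1 + b • p.2) := by fun_prop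
  exact (this.stronglyMeasurable.integral_prod_right (ν := stdGaussian E)).measurable

lemma gaussianNoise_mem_unitInterval (hf : Measurable f) (h : ∀ x, f x ∈ Set.Icc (0 : ℝ) 1)
    (a b : ℝ) (z : E) : gaussianNoise f a b z ∈ Set.Icc (0 : ℝ) 1 :=
  integral_mem_unitInterval (by fun_prop) fun y => h _

/-- The power is expanded with `k` independent copies of the noise sharing the same base point `x
0`. Moments of the noised function thereby become integrals of linear combinations, to which Gram
matrix comparison applies. -/
lemma integral_gaussianNoise_pow (hf : Measurable f) (h : ∀ x, f x ∈ Set.Icc (0 : ℝ) 1)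
    (a b : ℝ) (k : ℕ) :
    ∫ z, gaussianNoise f a b z ^ k ∂(stdGaussian E) =
      ∫ x : Fin (k + 1) → E, ∏ i : Fin k, f (a • x 0 + b • x i.succ)
        ∂(Measure.pi fun _ => stdGaussian E) := by
  rw [integral_pi_succ k (fun p => ∏ i : Fin k, f (a • p.1 + b • p.2 i)), integral_prod]
  · refine integral_congr_ae (Filter.Eventually.of_forall fun z => ?_)
    simp only
    rw [integral_fintype_prod_eq_pow (fun y => f (a • z + b • y)), Fintype.card_fin]
    rfl
  · refine integrable_of_mem_unitInterval (by fun_prop) fun p => ?_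
    exact ⟨Finset.prod_nonneg fun i _ => (h _).1,
      Finset.prod_le_one (fun i _ => (h _).1) fun i _ => (h _).2⟩

lemma integral_gaussianNoise (hf : Measurable f) (h : ∀ x, f x ∈ Set.Icc (0 : ℝ) 1)
    {a b : ℝ} (hab : a ^ 2 + b ^ 2 = 1) :
    ∫ z, gaussianNoise f a b z ∂(stdGaussian E) = ∫ z, f z ∂(stdGaussian E) := by
  have := integral_rotation (E := E) hab (F := fun p => f p.1) (by fun_prop)
  rw [integral_prod, integral_prod] at this
  · simpa [gaussianNoise] using this
  · exact integrable_of_mem_unitInterval (by fun_prop) fun p => h _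
  · exact integrable_of_mem_unitInterval (by fun_prop) fun p => h _

lemma noiseStability_eq_integral_mul (hf : Measurable f) (h : ∀ x, f x ∈ Set.Icc (0 : ℝ) 1)
    (ρ σ : ℝ) :
    noiseStability f ρ σ = ∫ z, f z * gaussianNoise f ρ σ z ∂(stdGaussian E) := by
  rw [noiseStability, integral_prod]
  · simp_rw [integral_const_mul]; rfl
  · exact integrable_of_mem_unitInterval (by fun_prop) fun p => mul_mem_unitInterval (h _) (h _)

/-- A pair with correlation `ρ = a ^ 2` can be realised as two noisy copies `a Z + b Y₁`, `a Z + b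
Y₂` of one vector `Z`; these are independent given `Z`. -/
lemma noiseStability_eq_integral_sq (hf : Measurable f) (h : ∀ x, f x ∈ Set.Icc (0 : ℝ) 1)
    {ρ σ a b : ℝ} (hρ : ρ ^ 2 + σ ^ 2 = 1) (hab : a ^ 2 + b ^ 2 = 1) (ha : a ^ 2 = ρ) :
    noiseStability f ρ σ = ∫ z, gaussianNoise f a b z ^ 2 ∂(stdGaussian E) := by
  have := integral_linComb_eq_of_gram_eq (E := E) !![1, 0; ρ, σ] !![a, b, 0; a, 0, b]
    (by
      ext i j
      fin_cases i <;> fin_cases j <;>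
        simp [Matrix.mul_apply, Fin.sum_univ_two, Fin.sum_univ_three] <;> linarith)
    (F := fun w => f (w 0) * f (w 1)) (by fun_prop)
  simp only [linComb_apply, Fin.sum_univ_two, Fin.sum_univ_three] at this
  rw [integral_gaussianNoise_pow hf h, noiseStability,
    ← integral_pi_two (fun p => f p.1 * f (ρ • p.1 + σ • p.2))]
  simpa [Fin.prod_univ_two] using this

/-- Noise stability at correlation `ρ` is controlled by noise stability at correlation `ρ ^ 2`. -/
lemma sq_noiseStability_le (hf : Measurable f) (h : ∀ x, f x ∈ Set.Icc (0 : ℝ) 1)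
    {ρ σ σ' : ℝ} (hρ : ρ ^ 2 + σ ^ 2 = 1) (hρ' : (ρ ^ 2) ^ 2 + σ' ^ 2 = 1) :
    noiseStability f ρ σ ^ 2 ≤ (∫ z, f z ∂(stdGaussian E)) * noiseStability f (ρ ^ 2) σ' := by
  have hg := measurable_gaussianNoise hf ρ σ
  have hg' := gaussianNoise_mem_unitInterval hf h ρ σ
  rw [noiseStability_eq_integral_mul hf h, noiseStability_eq_integral_sq hf h hρ' hρ rfl]
  -- Cauchy–Schwarz separates `f` from its noised version; the first factor is then reduced to the
  -- mean by `f ^ 2 ≤ f`.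
  refine (sq_integral_mul_le ?_ ?_ ?_).trans ?_
  · exact integrable_of_mem_unitInterval (by fun_prop) fun p => pow_mem_unitInterval (h _) 2
  · exact integrable_of_mem_unitInterval (by fun_prop) fun p => pow_mem_unitInterval (hg' _) 2
  · exact integrable_of_mem_unitInterval (by fun_prop) fun p => mul_mem_unitInterval (h _) (hg' _)
  · refine mul_le_mul_of_nonneg_right ?_ (integral_nonneg fun _ => sq_nonneg _)
    exact integral_mono
      (integrable_of_mem_unitInterval (by fun_prop) fun p => pow_mem_unitInterval (h _) 2)
      (integrable_of_mem_unitInterval hf h) fun x => sq_le_self_of_mem_unitInterval (h x)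

/-- A three-function Loomis–Whitney inequality for the triangle of Gaussian averages. -/
lemma sq_integral_triangle_le (hf : Measurable f) (h : ∀ x, f x ∈ Set.Icc (0 : ℝ) 1)
    {a : ℝ} (ha : a ^ 2 + a ^ 2 = 1) :
    (∫ x : Fin 3 → E, f (a • x 0 + a • x 1) * f (a • x 0 + a • x 2) * f (a • x 1 + a • x 2)
        ∂(Measure.pi fun _ => stdGaussian E)) ^ 2 ≤ (∫ z, f z ∂(stdGaussian E)) ^ 3 := by
  set γ := stdGaussian E
  set π₂ : Measure (Fin 2 → E) := Measure.pi fun _ => γ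
  set p := ∫ z, f z ∂γ
  have hp0 : 0 ≤ p := integral_nonneg fun x => (h x).1
  let g := gaussianNoise f a a
  have hg : Measurable g := measurable_gaussianNoise hf a a
  have hg' : ∀ z, g z ∈ Set.Icc (0 : ℝ) 1 := gaussianNoise_mem_unitInterval hf h a a
  -- `H` integrates out one vertex of the triangle, hence the two edges meeting there.
  -- Cauchy–Schwarz is used twice: inside `H`, giving `H w ^ 2 ≤ g (w 0) * g (w 1)` with independent
  -- factors, and between `H` and the remaining edge.
  let H : (Fin 2 → E) → ℝ := fun w => ∫ x, f (a • w 0 + a • x) * f (a • w 1 + a • x) ∂γ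
  have hH : Measurable H := by
    have : Measurable fun q : (Fin 2 → E) × E =>
      f (a • q.1 0 + a • q.2) * f (a • q.1 1 + a • q.2) := by fun_prop
    exact (this.stronglyMeasurable.integral_prod_right (ν := γ)).measurable
  have hH' : ∀ w, H w ∈ Set.Icc (0 : ℝ) 1 := fun w =>
    integral_mem_unitInterval (by fun_prop) fun y => mul_mem_unitInterval (h _) (h _)
  have e1 : ∫ x : Fin 3 → E, f (a • x 0 + a • x 1) * f (a • x 0 + a • x 2) *
      f (a • x 1 + a • x 2) ∂(Measure.pi fun _ => γ) =
      ∫ w : Fin 2 → E, f (a • w 0 + a • w 1) * H w ∂π₂ := by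
    have := integral_pi_succ (E := E) 2 (fun q => f (a • q.1 + a • q.2 0) *
      f (a • q.1 + a • q.2 1) * f (a • q.2 0 + a • q.2 1))
    simp only [Fin.succ_zero_eq_one, Fin.succ_one_eq_two] at this
    rw [this, integral_prod_symm]
    · refine integral_congr_ae (Filter.Eventually.of_forall fun w => ?_)
      simp only [H]
      rw [← integral_const_mul]
      refine integral_congr_ae (Filter.Eventually.of_forall fun x => ?_)
      simp only
      rw [add_comm (a • x), add_comm (a • x)]
      ring
    · exact integrable_of_mem_unitInterval (by fun_prop) fun q =>
        mul_mem_unitInterval (mul_mem_unitInterval (h _) (h _)) (h _)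
  have e2 : ∫ w : Fin 2 → E, f (a • w 0 + a • w 1) ∂π₂ = p := by
    have := integral_gaussianNoise_pow hf h a a 1
    simp only [pow_one, Finset.univ_unique, Fin.default_eq_zero, Finset.prod_singleton,
      Fin.succ_zero_eq_one] at this
    rw [integral_gaussianNoise hf h ha] at this
    exact this.symm
  have e3 : ∫ w : Fin 2 → E, g (w 0) * g (w 1) ∂π₂ = p ^ 2 := by
    have := integral_fintype_prod_eq_pow (ι := Fin 2) g (μ := γ)
    simp only [Fin.prod_univ_two, Fintype.card_fin] at this
    rw [this, integral_gaussianNoise hf h ha]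
  have hHsq : ∀ w, H w ^ 2 ≤ g (w 0) * g (w 1) := by
    intro w
    have hsq : ∀ z, ∫ x, f (a • z + a • x) ^ 2 ∂γ ≤ g z := fun z =>
      integral_mono
        (integrable_of_mem_unitInterval (by fun_prop) fun p => pow_mem_unitInterval (h _) 2)
        (integrable_of_mem_unitInterval (by fun_prop) fun p => h _)
        fun x => sq_le_self_of_mem_unitInterval (h _)
    refine (sq_integral_mul_le ?_ ?_ ?_).trans (mul_le_mul (hsq _) (hsq _)
      (integral_nonneg fun _ => sq_nonneg _) (hg' _).1)
    · exact integrable_of_mem_unitInterval (by fun_prop) fun p => pow_mem_unitInterval (h _) 2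
    · exact integrable_of_mem_unitInterval (by fun_prop) fun p => pow_mem_unitInterval (h _) 2
    · exact integrable_of_mem_unitInterval (by fun_prop) fun p => mul_mem_unitInterval (h _) (h _)
  have i1 : Integrable (fun w : Fin 2 → E => f (a • w 0 + a • w 1) ^ 2) π₂ :=
    integrable_of_mem_unitInterval (by fun_prop) fun p => pow_mem_unitInterval (h _) 2
  have i2 : Integrable (fun w : Fin 2 → E => H w ^ 2) π₂ :=
    integrable_of_mem_unitInterval (by fun_prop) fun p => pow_mem_unitInterval (hH' _) 2
  rw [e1]
  calc _ ≤ (∫ w : Fin 2 → E, f (a • w 0 + a • w 1) ^ 2 ∂π₂) * ∫ w, H w ^ 2 ∂π₂ :=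
        sq_integral_mul_le i1 i2
          (integrable_of_mem_unitInterval (by fun_prop) fun p => mul_mem_unitInterval (h _) (hH' _))
    _ ≤ p * p ^ 2 := by
        refine mul_le_mul ?_ ?_ (integral_nonneg fun _ => sq_nonneg _) hp0
        · rw [← e2]
          exact integral_mono i1 (integrable_of_mem_unitInterval (by fun_prop) fun p => h _)
            fun x => sq_le_self_of_mem_unitInterval (h _)
        · rw [← e3]
          exact integral_mono i2 (integrable_of_mem_unitInterval (by fun_prop)
            fun p => mul_mem_unitInterval (hg' _) (hg' _)) hHsq
    _ = p ^ 3 := by ring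

/-- A hypercontractive estimate for the noise operator at correlation `1 / √2`, on functions with
values in the unit interval: on indicators it is the contractivity from `L²` to `L³`. -/
lemma sq_integral_gaussianNoise_cube_le (hf : Measurable f) (h : ∀ x, f x ∈ Set.Icc (0 : ℝ) 1)
    {a : ℝ} (ha : a ^ 2 + a ^ 2 = 1) :
    (∫ z, gaussianNoise f a a z ^ 3 ∂(stdGaussian E)) ^ 2 ≤ (∫ z, f z ∂(stdGaussian E)) ^ 3 := by
  refine le_of_eq_of_le ?_ (sq_integral_triangle_le hf h ha)
  -- The star (three noisy copies of one vector) and the triangle (sums over pairs from three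
  -- vectors) have the same Gram matrix: `1` on the diagonal, `1 / 2` off it.
  have := integral_linComb_eq_of_gram_eq (E := E)
    !![a, a, 0, 0; a, 0, a, 0; a, 0, 0, a] !![a, a, 0; a, 0, a; 0, a, a]
    (by
      ext i j
      fin_cases i <;> fin_cases j <;>
        simp [Matrix.mul_apply, Fin.sum_univ_four, Fin.sum_univ_three])
    (F := fun w => f (w 0) * f (w 1) * f (w 2)) (by fun_prop)
  simp only [linComb_apply, Fin.sum_univ_four, Fin.sum_univ_three] at this
  rw [integral_gaussianNoise_pow hf h]
  congr 1
  simpa [Fin.prod_univ_three] using this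

/-- With `g` the noised function, the stability is `∫ g ^ 2`. Interpolating between `∫ g = p` and `∫
g ^ 3 ≤ p ^ (3 / 2)` gives `p ^ (5 / 4)`. -/
lemma noiseStability_half_pow_four_le (hf : Measurable f) (h : ∀ x, f x ∈ Set.Icc (0 : ℝ) 1)
    {σ : ℝ} (hσ : (1 / 2 : ℝ) ^ 2 + σ ^ 2 = 1) :
    noiseStability f (1 / 2) σ ^ 4 ≤ (∫ z, f z ∂(stdGaussian E)) ^ 5 := by
  set a : ℝ := √(1 / 2)
  have ha2 : a ^ 2 = 1 / 2 := Real.sq_sqrt (by norm_num)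
  have ha : a ^ 2 + a ^ 2 = 1 := by rw [ha2]; norm_num
  let g := gaussianNoise f a a
  have hg : Measurable g := measurable_gaussianNoise hf a a
  have hg' : ∀ z, g z ∈ Set.Icc (0 : ℝ) 1 := gaussianNoise_mem_unitInterval hf h a a
  have h1 : noiseStability f (1 / 2) σ = ∫ z, g z ^ 2 ∂(stdGaussian E) :=
    noiseStability_eq_integral_sq hf h hσ ha ha2
  have h2 : (∫ z, g z ^ 2 ∂(stdGaussian E)) ^ 2 ≤
      (∫ z, f z ∂(stdGaussian E)) * ∫ z, g z ^ 3 ∂(stdGaussian E) := by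
    have := sq_integral_mul_le (μ := stdGaussian E) (u := fun z => √(g z))
      (v := fun z => √(g z) * g z) ?_ ?_ ?_
    · rw [← integral_gaussianNoise hf h ha]
      refine le_of_eq_of_le ?_ (this.trans (le_of_eq ?_))
      · congr 2; ext z
        rw [← mul_assoc, Real.mul_self_sqrt (hg' z).1, sq]
      · congr 2
        · ext z; exact Real.sq_sqrt (hg' z).1
        · ext z; rw [mul_pow, Real.sq_sqrt (hg' z).1]; ring
    all_goals
      have hs : ∀ z, √(g z) ∈ Set.Icc (0 : ℝ) 1 := fun z =>
        ⟨Real.sqrt_nonneg _, Real.sqrt_le_one.2 (hg' z).2⟩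
      refine integrable_of_mem_unitInterval (by fun_prop) fun z => ?_
    · exact pow_mem_unitInterval (hs z) 2
    · exact pow_mem_unitInterval (mul_mem_unitInterval (hs z) (hg' z)) 2
    · exact mul_mem_unitInterval (hs z) (mul_mem_unitInterval (hs z) (hg' z))
  rw [h1]
  calc (∫ z, g z ^ 2 ∂(stdGaussian E)) ^ 4 = ((∫ z, g z ^ 2 ∂(stdGaussian E)) ^ 2) ^ 2 := by ring
    _ ≤ ((∫ z, f z ∂(stdGaussian E)) * ∫ z, g z ^ 3 ∂(stdGaussian E)) ^ 2 :=
        pow_le_pow_left₀ (sq_nonneg _) h2 2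
    _ = (∫ z, f z ∂(stdGaussian E)) ^ 2 * (∫ z, g z ^ 3 ∂(stdGaussian E)) ^ 2 := by ring
    _ ≤ (∫ z, f z ∂(stdGaussian E)) ^ 2 * (∫ z, f z ∂(stdGaussian E)) ^ 3 :=
        mul_le_mul_of_nonneg_left (sq_integral_gaussianNoise_cube_le hf h ha) (sq_nonneg _)
    _ = _ := by ring

/-- Small-set noise stability: at correlation `2 ^ (-1 / 2 ^ k)`, the noise stability of a
function of mean `p` is at most `p ^ (1 + 1 / (4 * 2 ^ k))`. -/
lemma noiseStability_pow_le (hf : Measurable f) (h : ∀ x, f x ∈ Set.Icc (0 : ℝ) 1) (k : ℕ)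
    {σ : ℝ} (hσ : Real.exp (-(Real.log 2 / 2 ^ k)) ^ 2 + σ ^ 2 = 1) :
    noiseStability f (Real.exp (-(Real.log 2 / 2 ^ k))) σ ^ (4 * 2 ^ k) ≤
      (∫ z, f z ∂(stdGaussian E)) ^ (4 * 2 ^ k + 1) := by
  have hp0 : 0 ≤ ∫ z, f z ∂(stdGaussian E) := integral_nonneg fun x => (h x).1
  induction k generalizing σ with
  | zero =>
    have : Real.exp (-(Real.log 2 / 2 ^ 0)) = 1 / 2 := by
      rw [pow_zero, div_one, Real.exp_neg, Real.exp_log (by norm_num), one_div]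
    rw [this] at hσ ⊢
    simpa using noiseStability_half_pow_four_le hf h hσ
  | succ k ih =>
    -- Passing from correlation `ρ ^ 2` to `ρ` averages the exponent with `1`, so its excess over
    -- `1` is halved at each step.
    set ρ := Real.exp (-(Real.log 2 / 2 ^ (k + 1)))
    have hρ : Real.exp (-(Real.log 2 / 2 ^ k)) = ρ ^ 2 := by
      rw [← Real.exp_nat_mul]
      congr 1
      push_cast
      rw [pow_succ]
      field_simp
    rw [hρ] at ih
    have hρ1 : ρ ^ 2 ≤ 1 := by nlinarith [sq_nonneg σ]
    have hσ' : (ρ ^ 2) ^ 2 + √(1 - (ρ ^ 2) ^ 2) ^ 2 = 1 := by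
      rw [Real.sq_sqrt (by nlinarith [sq_nonneg ρ])]; ring
    calc noiseStability f ρ σ ^ (4 * 2 ^ (k + 1))
        = (noiseStability f ρ σ ^ 2) ^ (4 * 2 ^ k) := by rw [← pow_mul]; congr 1; ring
      _ ≤ ((∫ z, f z ∂(stdGaussian E)) * noiseStability f (ρ ^ 2) √(1 - (ρ ^ 2) ^ 2)) ^
            (4 * 2 ^ k) :=
          pow_le_pow_left₀ (sq_nonneg _) (sq_noiseStability_le hf h hσ hσ') _
      _ = (∫ z, f z ∂(stdGaussian E)) ^ (4 * 2 ^ k) *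
            noiseStability f (ρ ^ 2) √(1 - (ρ ^ 2) ^ 2) ^ (4 * 2 ^ k) := mul_pow _ _ _
      _ ≤ (∫ z, f z ∂(stdGaussian E)) ^ (4 * 2 ^ k) *
            (∫ z, f z ∂(stdGaussian E)) ^ (4 * 2 ^ k + 1) :=
          mul_le_mul_of_nonneg_left (ih hσ') (pow_nonneg hp0 _)
      _ = (∫ z, f z ∂(stdGaussian E)) ^ (4 * 2 ^ (k + 1) + 1) := by
          rw [← pow_add]; congr 1; ring

/-- A function of mean at most `16 ^ (-2 ^ k)` loses half of its mass at correlation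
`2 ^ (-1 / 2 ^ k)`. -/
lemma noiseStability_le_half (hf : Measurable f) (h : ∀ x, f x ∈ Set.Icc (0 : ℝ) 1) (k : ℕ)
    {σ : ℝ} (hσ : Real.exp (-(Real.log 2 / 2 ^ k)) ^ 2 + σ ^ 2 = 1)
    (hp : ∫ z, f z ∂(stdGaussian E) ≤ (1 / 2) ^ (4 * 2 ^ k)) :
    noiseStability f (Real.exp (-(Real.log 2 / 2 ^ k))) σ ≤
      (∫ z, f z ∂(stdGaussian E)) * (1 / 2) := by
  have hp0 : 0 ≤ ∫ z, f z ∂(stdGaussian E) := integral_nonneg fun x => (h x).1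
  refine le_of_pow_le_pow_left₀ (n := 4 * 2 ^ k) (by positivity) (by positivity) ?_
  refine (noiseStability_pow_le hf h k hσ).trans ?_
  -- The one surplus factor `p` pays for `(1 / 2) ^ (4 * 2 ^ k)`.
  rw [mul_pow, pow_succ]
  exact mul_le_mul_of_nonneg_left hp (pow_nonneg hp0 _)

end Gaussian

/-! ### Absolute continuity and first absolute moments of Gaussian measures. -/

lemma absolutelyContinuous_pi {n : ℕ} (μ ν : Measure ℝ) [SigmaFinite μ] [SigmaFinite ν]
    (h : μ ≪ ν) :
    (Measure.pi fun _ : Fin n => μ) ≪ Measure.pi fun _ : Fin n => ν := by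
  induction n with
  | zero =>
    rw [Measure.pi_of_empty, Measure.pi_of_empty]
  | succ n ih =>
    have e1 := (measurePreserving_piFinSuccAbove (fun _ : Fin (n + 1) => μ) 0).symm
    have e2 := (measurePreserving_piFinSuccAbove (fun _ : Fin (n + 1) => ν) 0).symm
    rw [← e1.map_eq, ← e2.map_eq]
    exact (h.prod ih).map (MeasurableEquiv.measurable _)

lemma stdGaussian_absolutelyContinuous_volume (d : ℕ) :
    stdGaussian (EuclideanSpace ℝ (Fin d)) ≪ volume := by
  rw [← map_pi_eq_stdGaussian, ← (PiLp.volume_preserving_toLp (Fin d)).map_eq]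
  exact (absolutelyContinuous_pi _ _ (gaussianReal_absolutelyContinuous 0 one_ne_zero)).map
    (by fun_prop)

lemma integral_abs_gaussianReal : ∫ x, |x| ∂(gaussianReal 0 1) = √(2 / Real.pi) := by
  rw [integral_gaussianReal_eq_integral_smul one_ne_zero]
  have h1 : ∫ x : ℝ, gaussianPDFReal 0 1 x • |x| =
      ∫ x : ℝ, (fun t => (√(2 * Real.pi))⁻¹ * (t * Real.exp (-(1 / 2) * t ^ 2))) |x| := by
    refine integral_congr_ae (Filter.Eventually.of_forall fun x => ?_)
    simp only [gaussianPDFReal_def, smul_eq_mul, sq_abs]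
    simp
    ring_nf
  rw [h1, integral_comp_abs (f := fun t => (√(2 * Real.pi))⁻¹ * (t * Real.exp (-(1 / 2) * t ^ 2))),
    integral_const_mul]
  have h2 := integral_rpow_mul_exp_neg_mul_rpow (p := 2) (q := 1) (b := 1 / 2) (by norm_num)
    (by norm_num) (by norm_num)
  have h3 : ∫ x in Set.Ioi (0 : ℝ), x * Real.exp (-(1 / 2) * x ^ 2) = 1 := by
    norm_num at h2 ⊢
    exact h2
  rw [h3, mul_one, Real.sqrt_mul (by norm_num), Real.sqrt_div (by norm_num)]
  have : √2 * √2 = 2 := Real.mul_self_sqrt (by norm_num)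
  have : √2 ≠ 0 := by positivity
  have : √Real.pi ≠ 0 := by positivity
  field_simp
  linarith

section Gaussian

variable {E : Type*} [NormedAddCommGroup E] [InnerProductSpace ℝ E] [FiniteDimensional ℝ E]
  [MeasurableSpace E] [BorelSpace E]

lemma integral_abs_dual_stdGaussian (L : StrongDual ℝ E) :
    ∫ y, |L y| ∂(stdGaussian E) = √(2 / Real.pi) * ‖L‖ := by
  have h1 : (stdGaussian E).map L = (gaussianReal 0 1).map (‖L‖ * ·) := by
    rw [IsGaussian.map_eq_gaussianReal, integral_strongDual_stdGaussian, variance_dual_stdGaussian,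
      gaussianReal_map_const_mul, mul_zero, mul_one]
    congr 1
    ext
    simp
  rw [← integral_map (f := fun t : ℝ => |t|) L.continuous.aemeasurable (by fun_prop), h1,
    integral_map (by fun_prop) (by fun_prop)]
  simp_rw [abs_mul, abs_norm]
  rw [integral_const_mul, integral_abs_gaussianReal, mul_comm]

/-! ### Oscillation along rotations and the Maurey–Pisier inequality. -/

lemma one_sub_cos_le_abs (h : ℝ) : |1 - Real.cos h| ≤ |h| := by
  have h1 := Real.one_sub_sq_div_two_le_cos (x := h)
  have h2 := Real.neg_one_le_cos h
  have h3 := Real.cos_le_one h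
  rw [abs_of_nonneg (by linarith)]
  rcases le_total |h| 2 with h4 | h4
  · nlinarith [sq_abs h, abs_nonneg h]
  · linarith

omit [FiniteDimensional ℝ E] [MeasurableSpace E] [BorelSpace E] in
lemma abs_sub_rotation_le {f : E → ℝ} {K : ℝ≥0} (hf : LipschitzWith K f) (θ : ℝ) (p : E × E) :
    |f p.1 - f (Real.cos θ • p.1 + Real.sin θ • p.2)| ≤ K * (|θ| * (‖p.1‖ + ‖p.2‖)) := by
  rw [← Real.dist_eq]
  refine (hf.dist_le_mul _ _).trans (mul_le_mul_of_nonneg_left ?_ K.2)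
  rw [dist_eq_norm]
  have : p.1 - (Real.cos θ • p.1 + Real.sin θ • p.2) =
      (1 - Real.cos θ) • p.1 - Real.sin θ • p.2 := by rw [sub_smul, one_smul]; abel
  rw [this, mul_add]
  refine (norm_sub_le _ _).trans (add_le_add ?_ ?_)
  · rw [norm_smul, Real.norm_eq_abs]
    exact mul_le_mul_of_nonneg_right (one_sub_cos_le_abs θ) (norm_nonneg _)
  · rw [norm_smul, Real.norm_eq_abs]
    exact mul_le_mul_of_nonneg_right Real.abs_sin_le_abs (norm_nonneg _)

lemma integrable_norm_add_norm :
    Integrable (fun p : E × E => ‖p.1‖ + ‖p.2‖) ((stdGaussian E).prod (stdGaussian E)) := by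
  have h : Integrable (fun x : E => ‖x‖) (stdGaussian E) :=
    (IsGaussian.integrable_id (μ := stdGaussian E)).norm
  exact (h.comp_fst _).add (h.comp_snd _)

/-- The mean oscillation of `f` along a rotation of angle `θ`. -/
noncomputable def rotationOscillation (f : E → ℝ) (θ : ℝ) : ℝ :=
  ∫ p, |f p.1 - f (Real.cos θ • p.1 + Real.sin θ • p.2)| ∂((stdGaussian E).prod (stdGaussian E))

variable {f : E → ℝ} {K : ℝ≥0}

lemma integrable_rotation_sub (hf : LipschitzWith K f) (θ : ℝ) :
    Integrable (fun p : E × E => |f p.1 - f (Real.cos θ • p.1 + Real.sin θ • p.2)|)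
      ((stdGaussian E).prod (stdGaussian E)) := by
  have hfc := hf.continuous
  refine Integrable.mono' ((integrable_norm_add_norm.const_mul |θ|).const_mul K)
    (by fun_prop) (Filter.Eventually.of_forall fun p => ?_)
  rw [Real.norm_eq_abs, abs_abs]
  exact abs_sub_rotation_le hf θ p

/-- Triangle inequality through the intermediate angle `s`. The rotated pair at angle `s` is again a
pair of independent standard Gaussian vectors, so the second leg has the oscillation of angle `t`.
-/
lemma rotationOscillation_add_le (hf : LipschitzWith K f) (s t : ℝ) :
    rotationOscillation f (s + t) ≤ rotationOscillation f s + rotationOscillation f t := by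
  have hfc := hf.continuous
  have h1 := integral_rotation (E := E) (Real.cos_sq_add_sin_sq s)
    (F := fun p => |f p.1 - f (Real.cos t • p.1 + Real.sin t • p.2)|) (by fun_prop)
  simp only at h1
  have h2 : ∀ p : E × E, Real.cos t • (Real.cos s • p.1 + Real.sin s • p.2) +
      Real.sin t • (-Real.sin s • p.1 + Real.cos s • p.2) =
      Real.cos (s + t) • p.1 + Real.sin (s + t) • p.2 := by
    intro p
    rw [Real.cos_add, Real.sin_add]
    module
  simp_rw [h2] at h1
  have hi : Integrable (fun p : E × E => |f (Real.cos s • p.1 + Real.sin s • p.2) -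
      f (Real.cos (s + t) • p.1 + Real.sin (s + t) • p.2)|)
      ((stdGaussian E).prod (stdGaussian E)) := by
    refine Integrable.mono' ((integrable_rotation_sub hf s).add
      (integrable_rotation_sub hf (s + t))) (by fun_prop)
      (Filter.Eventually.of_forall fun p => ?_)
    rw [Real.norm_eq_abs, abs_abs, Pi.add_apply, abs_sub_comm (f p.1) (f (Real.cos s • p.1 + _))]
    exact abs_sub_le _ _ _
  unfold rotationOscillation
  rw [← h1, ← integral_add (integrable_rotation_sub hf s) hi]
  exact integral_mono (integrable_rotation_sub hf _) ((integrable_rotation_sub hf s).add hi)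
    fun p => abs_sub_le _ _ _

lemma rotationOscillation_nsmul_le (hf : LipschitzWith K f) (n : ℕ) (t : ℝ) :
    rotationOscillation f (n * t) ≤ n * rotationOscillation f t := by
  induction n with
  | zero => simp [rotationOscillation]
  | succ n ih =>
    push_cast
    rw [add_mul, add_mul, one_mul, one_mul]
    exact (rotationOscillation_add_le hf _ _).trans (by linarith)

lemma measurable_fderiv_apply_pair (f : E → ℝ) :
    Measurable fun p : E × E => fderiv ℝ f p.1 p.2 := by
  have h : Continuous fun q : (E →L[ℝ] ℝ) × E => q.1 q.2 := isBoundedBilinearMap_apply.continuous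
  exact h.measurable.comp (((measurable_fderiv ℝ f).comp measurable_fst).prodMk measurable_snd)

/-- Small rotations move `x` in the direction `θ y` to first order, so the rescaled differences
converge wherever `f` is differentiable; the Lipschitz bound dominates them uniformly in `n`. -/
lemma tendsto_rotationOscillation (hf : LipschitzWith K f)
    (hd : ∀ᵐ x ∂(stdGaussian E), DifferentiableAt ℝ f x) (θ : ℝ) :
    Filter.Tendsto (fun n : ℕ => ((n : ℝ) + 1) * rotationOscillation f (θ / ((n : ℝ) + 1)))
      Filter.atTop (nhds (∫ p : E × E, |θ * fderiv ℝ f p.1 p.2|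
        ∂((stdGaussian E).prod (stdGaussian E)))) := by
  have hfc := hf.continuous
  unfold rotationOscillation
  simp_rw [← integral_const_mul]
  refine tendsto_integral_of_dominated_convergence
    (fun p : E × E => K * (|θ| * (‖p.1‖ + ‖p.2‖))) (fun n => by fun_prop)
    ((integrable_norm_add_norm.const_mul |θ|).const_mul K) (fun n => ?_) ?_
  · refine Filter.Eventually.of_forall fun p => ?_
    have hn : (0 : ℝ) < (n : ℝ) + 1 := by positivity
    rw [norm_mul, Real.norm_eq_abs, Real.norm_eq_abs, abs_abs, abs_of_pos hn]
    refine (mul_le_mul_of_nonneg_left (abs_sub_rotation_le hf _ p) hn.le).trans (le_of_eq ?_)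
    rw [abs_div, abs_of_pos hn]
    field_simp
  · have hd' : ∀ᵐ p : E × E ∂((stdGaussian E).prod (stdGaussian E)),
        DifferentiableAt ℝ f p.1 := Measure.quasiMeasurePreserving_fst.ae hd
    filter_upwards [hd'] with p hp
    have hu : HasDerivAt (fun t : ℝ => Real.cos (θ * t) • p.1 + Real.sin (θ * t) • p.2)
        (θ • p.2) 0 := by
      have hl : HasDerivAt (fun t : ℝ => θ * t) θ 0 := by
        simpa using (hasDerivAt_id (0 : ℝ)).const_mul θ
      have h1 := (hl.cos.smul_const p.1).add (hl.sin.smul_const p.2)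
      refine HasDerivAt.congr_deriv h1 ?_
      simp
    have hfu : HasDerivAt (fun t : ℝ => f (Real.cos (θ * t) • p.1 + Real.sin (θ * t) • p.2))
        (fderiv ℝ f p.1 (θ • p.2)) 0 := by
      have hp' : HasFDerivAt f (fderiv ℝ f p.1)
          (Real.cos (θ * 0) • p.1 + Real.sin (θ * 0) • p.2) := by
        simpa using hp.hasFDerivAt
      exact hp'.comp_hasDerivAt (0 : ℝ) hu
    have hs := hasDerivAt_iff_tendsto_slope_zero.1 hfu
    have ht : Filter.Tendsto (fun n : ℕ => 1 / ((n : ℝ) + 1)) Filter.atTop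
        (nhdsWithin 0 {0}ᶜ) := by
      refine tendsto_nhdsWithin_iff.2 ⟨tendsto_one_div_add_atTop_nhds_zero_nat,
        Filter.Eventually.of_forall fun n => ?_⟩
      have : (0 : ℝ) < 1 / ((n : ℝ) + 1) := by positivity
      exact this.ne'
    have := (hs.comp ht).abs
    rw [map_smul, smul_eq_mul] at this
    refine this.congr fun n => ?_
    have hn : (0 : ℝ) < (n : ℝ) + 1 := by positivity
    simp only [Function.comp_apply, zero_add, mul_zero, Real.cos_zero, Real.sin_zero, one_smul,
      zero_smul, add_zero, smul_eq_mul, one_div, inv_inv]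
    rw [abs_mul, abs_of_pos hn, abs_sub_comm, div_eq_mul_inv]

/-- The Maurey–Pisier inequality in `L¹` form: the mean oscillation of a Lipschitz function along a
rotation of angle `θ` is at most `θ √(2 / π)` times the mean norm of its derivative. -/
theorem rotationOscillation_le (hf : LipschitzWith K f)
    (hd : ∀ᵐ x ∂(stdGaussian E), DifferentiableAt ℝ f x) {θ : ℝ} (hθ : 0 ≤ θ) :
    rotationOscillation f θ ≤
      θ * √(2 / Real.pi) * ∫ x, ‖fderiv ℝ f x‖ ∂(stdGaussian E) := by
  have h1 : rotationOscillation f θ ≤ ∫ p : E × E, |θ * fderiv ℝ f p.1 p.2|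
        ∂((stdGaussian E).prod (stdGaussian E)) := by
    -- The angle is cut into `n + 1` equal parts; subadditivity bounds the whole by each term of the
    -- sequence.
    refine ge_of_tendsto' (tendsto_rotationOscillation hf hd θ) fun n => ?_
    have := rotationOscillation_nsmul_le hf (n + 1) (θ / ((n : ℝ) + 1))
    push_cast at this
    rwa [mul_div_cancel₀ _ (by positivity)] at this
  refine h1.trans (le_of_eq ?_)
  have hi : Integrable (fun p : E × E => |θ * fderiv ℝ f p.1 p.2|)
      ((stdGaussian E).prod (stdGaussian E)) := by
    have hm := measurable_fderiv_apply_pair f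
    refine Integrable.mono' ((integrable_norm_add_norm.const_mul K).const_mul |θ|)
      (by fun_prop) (Filter.Eventually.of_forall fun p => ?_)
    rw [Real.norm_eq_abs, abs_abs, abs_mul]
    refine mul_le_mul_of_nonneg_left ?_ (abs_nonneg _)
    refine ((fderiv ℝ f p.1).le_opNorm p.2).trans ?_
    exact mul_le_mul (norm_fderiv_le_of_lipschitz ℝ hf) (by linarith [norm_nonneg p.1])
      (norm_nonneg _) K.2
  rw [integral_prod _ hi, ← integral_const_mul]
  refine integral_congr_ae (Filter.Eventually.of_forall fun x => ?_)
  simp only [abs_mul]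
  rw [integral_const_mul, integral_abs_dual_stdGaussian, abs_of_nonneg hθ, mul_assoc]

end Gaussian

/-! ### Level sets of Lipschitz functions with values in the unit interval. -/

section Gaussian

variable {E : Type*} [NormedAddCommGroup E] [InnerProductSpace ℝ E] [FiniteDimensional ℝ E]
  [MeasurableSpace E] [BorelSpace E]

omit [NormedAddCommGroup E] [InnerProductSpace ℝ E] [FiniteDimensional ℝ E] [MeasurableSpace E]
  [BorelSpace E] in
lemma indicator_one_mem_unitInterval (U : Set E) (x : E) :
    U.indicator (fun _ => (1 : ℝ)) x ∈ Set.Icc (0 : ℝ) 1 := by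
  by_cases h : x ∈ U <;> simp [h]

omit [BorelSpace E] in
lemma integral_indicator_one_stdGaussian {U : Set E} (hU : MeasurableSet U) :
    ∫ x, U.indicator (fun _ => (1 : ℝ)) x ∂(stdGaussian E) = (stdGaussian E).real U := by
  rw [integral_indicator_const _ hU, smul_eq_mul, mul_one]

lemma integral_rotation_fst {g : E → ℝ} (hg : Measurable g) {c s : ℝ} (h : c ^ 2 + s ^ 2 = 1) :
    ∫ p : E × E, g (c • p.1 + s • p.2) ∂((stdGaussian E).prod (stdGaussian E)) =
      ∫ x, g x ∂(stdGaussian E) := by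
  have := integral_rotation (E := E) h (F := fun p => g p.1) (by fun_prop)
  rw [this]
  simpa using integral_fun_fst (μ := stdGaussian E) (ν := stdGaussian E) g

/-- The oscillation of a function with values in the unit interval is bounded below by the mass of
its level set `{f = 1}` and the noise stability of its support. -/
lemma sub_noiseStability_le_rotationOscillation {f : E → ℝ} {K : ℝ≥0} (hf : LipschitzWith K f)
    (h : ∀ x, f x ∈ Set.Icc (0 : ℝ) 1) (θ : ℝ) :
    2 * (stdGaussian E).real {x | f x = 1} -
      2 * noiseStability ({x | 0 < f x}.indicator fun _ => 1) (Real.cos θ) (Real.sin θ) ≤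
      rotationOscillation f θ := by
  have hfc := hf.continuous
  have hB : MeasurableSet {x | f x = 1} := (isClosed_eq hfc continuous_const).measurableSet
  have hU : MeasurableSet {x | 0 < f x} := (isOpen_lt continuous_const hfc).measurableSet
  set b : E → ℝ := {x | f x = 1}.indicator fun _ => 1
  set u : E → ℝ := {x | 0 < f x}.indicator fun _ => 1
  have hb : Measurable b := measurable_const.indicator hB
  have hu : Measurable u := measurable_const.indicator hU
  have hbI := indicator_one_mem_unitInterval {x | f x = 1}
  have huI := indicator_one_mem_unitInterval {x | 0 < f x}
  -- The left side is positive only when one point lies in `{f = 1}` and the other in `{f = 0}`, and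
  -- then both sides equal `1`.
  have key : ∀ x y, b x + b y - 2 * (u x * u y) ≤ |f x - f y| := by
    intro x y
    by_cases hx : f x = 1
    · by_cases hy : f y = 1
      · simp [b, u, hx, hy]; norm_num
      · by_cases hy' : 0 < f y
        · simp only [b, u, Set.indicator, Set.mem_ofPred_eq, hx, hy, hy']
          norm_num
          linarith [abs_nonneg (1 - f y)]
        · have : f y = 0 := le_antisymm (not_lt.1 hy') (h y).1
          simp [b, u, hx, this]
    · by_cases hy : f y = 1
      · by_cases hx' : 0 < f x
        · simp only [b, u, Set.indicator, Set.mem_ofPred_eq, hx, hy, hx']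
          norm_num
          linarith [abs_nonneg (f x - 1)]
        · have : f x = 0 := le_antisymm (not_lt.1 hx') (h x).1
          simp [b, u, hy, this]
      · have h1 : 0 ≤ u x * u y := mul_nonneg (huI x).1 (huI y).1
        have h2 : b x = 0 := by simp [b, hx]
        have h3 : b y = 0 := by simp [b, hy]
        rw [h2, h3]
        linarith [abs_nonneg (f x - f y)]
  have i1 : Integrable (fun p : E × E => b p.1) ((stdGaussian E).prod (stdGaussian E)) :=
    integrable_of_mem_unitInterval (by fun_prop) fun p => hbI _
  have i2 : Integrable (fun p : E × E => b (Real.cos θ • p.1 + Real.sin θ • p.2))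
      ((stdGaussian E).prod (stdGaussian E)) :=
    integrable_of_mem_unitInterval (by fun_prop) fun p => hbI _
  have i3 : Integrable (fun p : E × E => u p.1 * u (Real.cos θ • p.1 + Real.sin θ • p.2))
      ((stdGaussian E).prod (stdGaussian E)) :=
    integrable_of_mem_unitInterval (by fun_prop) fun p => mul_mem_unitInterval (huI _) (huI _)
  have i12 : Integrable (fun p : E × E => b p.1 + b (Real.cos θ • p.1 + Real.sin θ • p.2))
      ((stdGaussian E).prod (stdGaussian E)) := i1.add i2
  have hint := integral_mono (i12.sub (i3.const_mul 2)) (integrable_rotation_sub hf θ)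
    fun p : E × E => key p.1 (Real.cos θ • p.1 + Real.sin θ • p.2)
  simp only [Pi.sub_apply] at hint
  rw [integral_sub i12 (i3.const_mul 2), integral_add i1 i2, integral_const_mul,
    integral_rotation_fst hb (Real.cos_sq_add_sin_sq θ)] at hint
  have e1 : ∫ p : E × E, b p.1 ∂((stdGaussian E).prod (stdGaussian E)) =
      ∫ x, b x ∂(stdGaussian E) := by
    simpa using integral_fun_fst (μ := stdGaussian E) (ν := stdGaussian E) b
  rw [e1, integral_indicator_one_stdGaussian hB] at hint
  refine le_trans (le_of_eq ?_) hint
  rw [noiseStability]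
  ring

/-- The derivative of a Lipschitz function with values in the unit interval lives on the set where
the function is strictly between `0` and `1`. -/
lemma integral_norm_fderiv_le {f : E → ℝ} {K : ℝ≥0} (hf : LipschitzWith K f)
    (h : ∀ x, f x ∈ Set.Icc (0 : ℝ) 1) :
    ∫ x, ‖fderiv ℝ f x‖ ∂(stdGaussian E) ≤
      K * ((stdGaussian E).real {x | 0 < f x} - (stdGaussian E).real {x | f x = 1}) := by
  have hfc := hf.continuous
  have hB : MeasurableSet {x | f x = 1} := (isClosed_eq hfc continuous_const).measurableSet
  have hU : MeasurableSet {x | 0 < f x} := (isOpen_lt continuous_const hfc).measurableSet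
  have hsub : {x | f x = 1} ⊆ {x | 0 < f x} := fun x (hx : f x = 1) => by
    simp [hx]
  have key : ∀ x, ‖fderiv ℝ f x‖ ≤
      ({x | 0 < f x} \ {x | f x = 1}).indicator (fun _ => (K : ℝ)) x := by
    intro x
    by_cases hx : x ∈ {x | 0 < f x} \ {x | f x = 1}
    · rw [Set.indicator_of_mem hx]
      exact norm_fderiv_le_of_lipschitz ℝ hf
    · rw [Set.indicator_of_notMem hx]
      -- Off the transition region `f` attains its global minimum `0` or maximum `1`.
      have hz : fderiv ℝ f x = 0 := by
        rcases (h x).1.eq_or_lt with h0 | h0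
        · refine IsLocalMin.fderiv_eq_zero (Filter.Eventually.of_forall fun y => ?_)
          rw [← h0]; exact (h y).1
        · have h1 : f x = 1 := by
            by_contra h1
            exact hx ⟨h0, h1⟩
          refine IsLocalMax.fderiv_eq_zero (Filter.Eventually.of_forall fun y => ?_)
          rw [h1]; exact (h y).2
      rw [hz, norm_zero]
  refine (integral_mono_of_nonneg (Filter.Eventually.of_forall fun x => norm_nonneg _)
    ((integrable_const _).indicator (hU.diff hB)) (Filter.Eventually.of_forall key)).trans ?_
  rw [integral_indicator_const _ (hU.diff hB), measureReal_sdiff hsub hB, smul_eq_mul, mul_comm]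

lemma noiseStability_zero_one {f : E → ℝ} (hf : Measurable f)
    (h : ∀ x, f x ∈ Set.Icc (0 : ℝ) 1) :
    noiseStability f 0 1 = (∫ x, f x ∂(stdGaussian E)) ^ 2 := by
  rw [noiseStability_eq_integral_mul hf h]
  simp only [gaussianNoise, zero_smul, one_smul, zero_add]
  rw [integral_mul_const, sq]

end Gaussian

/-! ### Isoperimetry for balanced families. -/

section Family

variable {d m : ℕ} {f : Fin m → EuclideanSpace ℝ (Fin d) → ℝ} {K : ℝ≥0}

local notation "γ" => stdGaussian (EuclideanSpace ℝ (Fin d))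

/-- For each cell, the two bounds on the oscillation combine into one inequality that is linear in
the masses of `{f i > 0}` and `{f i = 1}`. After summation, the former total at most `1`. -/
lemma sum_sub_noiseStability_le (hf : ∀ i, LipschitzWith K (f i))
    (h : ∀ i x, f i x ∈ Set.Icc (0 : ℝ) 1) (hm : 2 ≤ m)
    (hU : ∀ i, (γ).real {x | 0 < f i x} ≤ 1 / (m : ℝ)) {θ : ℝ} (hθ : 0 ≤ θ)
    (hN : ∀ i, noiseStability ({x | 0 < f i x}.indicator fun _ => 1) (Real.cos θ) (Real.sin θ) ≤
      (γ).real {x | 0 < f i x} * (1 / 2)) :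
    2 * ∑ i, (γ).real {x | f i x = 1} - 1 ≤
      θ * √(2 / Real.pi) * (K * (1 - ∑ i, (γ).real {x | f i x = 1})) := by
  have hm0 : (0 : ℝ) < m := by positivity
  have hsum : ∑ i, (γ).real {x | 0 < f i x} ≤ 1 := by
    refine (Finset.sum_le_sum fun i _ => hU i).trans ?_
    simp [hm0.ne']
  have hone : ∀ i, 2 * (γ).real {x | f i x = 1} - (γ).real {x | 0 < f i x} ≤
      θ * √(2 / Real.pi) * (K * ((γ).real {x | 0 < f i x} - (γ).real {x | f i x = 1})) := by
    intro i
    have h1 := sub_noiseStability_le_rotationOscillation (hf i) (h i) θ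
    have h2 := rotationOscillation_le (hf i)
      ((stdGaussian_absolutelyContinuous_volume d).ae_le (hf i).ae_differentiableAt) hθ
    have h3 := mul_le_mul_of_nonneg_left (integral_norm_fderiv_le (hf i) (h i))
      (mul_nonneg hθ (Real.sqrt_nonneg (2 / Real.pi)))
    linarith [hN i]
  have hall := Finset.sum_le_sum fun i (_ : i ∈ Finset.univ) => hone i
  rw [Finset.sum_sub_distrib, ← Finset.mul_sum, ← Finset.mul_sum, ← Finset.mul_sum,
    Finset.sum_sub_distrib] at hall
  have : θ * √(2 / Real.pi) * (K * (∑ i, (γ).real {x | 0 < f i x} -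
      ∑ i, (γ).real {x | f i x = 1})) ≤
      θ * √(2 / Real.pi) * (K * (1 - ∑ i, (γ).real {x | f i x = 1})) := by
    gcongr
  linarith

/-- Isoperimetry for a balanced family, with the sharp constant for two cells. -/
theorem two_mul_sum_sub_one_le (hf : ∀ i, LipschitzWith K (f i))
    (h : ∀ i x, f i x ∈ Set.Icc (0 : ℝ) 1) (hm : 2 ≤ m)
    (hU : ∀ i, (γ).real {x | 0 < f i x} ≤ 1 / (m : ℝ)) :
    2 * ∑ i, (γ).real {x | f i x = 1} - 1 ≤
      √(Real.pi / 2) * (K * (1 - ∑ i, (γ).real {x | f i x = 1})) := by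
  have hθ : Real.pi / 2 * √(2 / Real.pi) = √(Real.pi / 2) := by
    have hpi := Real.pi_pos
    have h1 : √(2 / Real.pi) = (√(Real.pi / 2))⁻¹ := by rw [← Real.sqrt_inv, inv_div]
    have h2 : √(Real.pi / 2) * √(Real.pi / 2) = Real.pi / 2 := Real.mul_self_sqrt (by positivity)
    have h3 : √(Real.pi / 2) ≠ 0 := by positivity
    rw [h1]
    nth_rewrite 1 [← h2]
    field_simp
  rw [← hθ]
  refine sum_sub_noiseStability_le hf h hm hU (by positivity) fun i => ?_
  have hUm : MeasurableSet {x | 0 < f i x} :=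
    (isOpen_lt continuous_const (hf i).continuous).measurableSet
  rw [Real.cos_pi_div_two, Real.sin_pi_div_two,
    noiseStability_zero_one (measurable_const.indicator hUm) (indicator_one_mem_unitInterval _),
    integral_indicator_one_stdGaussian hUm, sq]
  refine mul_le_mul_of_nonneg_left ((hU i).trans ?_) measureReal_nonneg
  have : (2 : ℝ) ≤ m := by exact_mod_cast hm
  exact one_div_le_one_div_of_le (by norm_num) this

/-- Isoperimetry for a balanced family of many cells. -/
theorem two_mul_sum_sub_one_le_arccos (hf : ∀ i, LipschitzWith K (f i))
    (h : ∀ i x, f i x ∈ Set.Icc (0 : ℝ) 1) {k : ℕ} (hm : 16 ^ (2 ^ k) ≤ m)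
    (hU : ∀ i, (γ).real {x | 0 < f i x} ≤ 1 / (m : ℝ)) :
    2 * ∑ i, (γ).real {x | f i x = 1} - 1 ≤
      Real.arccos (Real.exp (-(Real.log 2 / 2 ^ k))) * √(2 / Real.pi) *
        (K * (1 - ∑ i, (γ).real {x | f i x = 1})) := by
  have hm2 : 2 ≤ m := by
    have : 16 ^ 1 ≤ 16 ^ (2 ^ k) := Nat.pow_le_pow_right (by norm_num) Nat.one_le_two_pow
    omega
  have hl : 0 ≤ Real.log 2 / 2 ^ k := by positivity
  have h1 : Real.exp (-(Real.log 2 / 2 ^ k)) ≤ 1 := Real.exp_le_one_iff.2 (by linarith)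
  have h0 := Real.exp_pos (-(Real.log 2 / 2 ^ k))
  refine sum_sub_noiseStability_le hf h hm2 hU (Real.arccos_nonneg _) fun i => ?_
  have hUm : MeasurableSet {x | 0 < f i x} :=
    (isOpen_lt continuous_const (hf i).continuous).measurableSet
  have hcos := Real.cos_arccos (by linarith) h1
  have hσ := Real.cos_sq_add_sin_sq (Real.arccos (Real.exp (-(Real.log 2 / 2 ^ k))))
  rw [hcos] at hσ ⊢
  rw [← integral_indicator_one_stdGaussian hUm]
  refine noiseStability_le_half (measurable_const.indicator hUm)
    (indicator_one_mem_unitInterval _) k hσ ?_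
  rw [integral_indicator_one_stdGaussian hUm]
  refine (hU i).trans ?_
  have : ((16 : ℝ) ^ (2 ^ k)) ≤ m := by exact_mod_cast hm
  calc 1 / (m : ℝ) ≤ 1 / 16 ^ (2 ^ k) := one_div_le_one_div_of_le (by positivity) this
    _ = (1 / 2) ^ (4 * 2 ^ k) := by
        rw [pow_mul, ← one_div_pow]; norm_num

end Family

/-! ### Numerical consequences of the isoperimetric inequalities. -/

/-- With `θ` the arccosine, `(2 / π ^ 2) θ ^ 2 ≤ 1 - cos θ = 1 - exp (-t) ≤ t`. -/
lemma arccos_exp_sq_le (t : ℝ) (ht : 0 ≤ t) :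
    Real.arccos (Real.exp (-t)) ^ 2 ≤ Real.pi ^ 2 / 2 * t := by
  have h1 : Real.exp (-t) ≤ 1 := Real.exp_le_one_iff.2 (by linarith)
  have h0 := Real.exp_pos (-t)
  have h3 := Real.cos_le_one_sub_mul_cos_sq (x := Real.arccos (Real.exp (-t)))
    (by rw [abs_of_nonneg (Real.arccos_nonneg _)]; exact Real.arccos_le_pi _)
  rw [Real.cos_arccos (by linarith) h1] at h3
  have h4 := Real.add_one_le_exp (-t)
  have h5 : 2 / Real.pi ^ 2 * Real.arccos (Real.exp (-t)) ^ 2 ≤ t := by linarith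
  have hpi := Real.pi_pos
  have h6 := mul_le_mul_of_nonneg_left h5 (by positivity : 0 ≤ Real.pi ^ 2 / 2)
  calc _ = Real.pi ^ 2 / 2 * (2 / Real.pi ^ 2 * Real.arccos (Real.exp (-t)) ^ 2) := by
        field_simp
    _ ≤ _ := h6

/-- The largest admissible `k` makes `2 ^ k` comparable to `log m`, so the dyadic choice of angle
costs only a constant factor. -/
lemma exists_pow_two_pow_le {m : ℕ} (hm : 16 ≤ m) :
    ∃ k, 16 ^ (2 ^ k) ≤ m ∧ m < 16 ^ (2 ^ (k + 1)) := by
  have h1 : Nat.log 16 m ≠ 0 := (Nat.log_pos (by norm_num) hm).ne'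
  refine ⟨Nat.log 2 (Nat.log 16 m), ?_, ?_⟩
  · exact (Nat.pow_le_pow_right (by norm_num) (Nat.pow_log_le_self 2 h1)).trans
      (Nat.pow_log_le_self 16 (by omega))
  · exact (Nat.lt_pow_succ_log_self (by norm_num) m).trans_le
      (Nat.pow_le_pow_right (by norm_num) (Nat.lt_pow_succ_log_self (by norm_num) _))

lemma le_one_sub_mul_of_isoperimetry {m : ℕ} (hm : 2 ≤ m) {a ε : ℝ} (hε : 0 < ε)
    (h : 2 * a - 1 ≤ √(Real.pi / 2) * (2 / ε * (1 - a))) :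
    a ≤ 1 - ε * (1 - ε * √(2 * Real.log (m : ℝ))) / √(2 * Real.pi) := by
  have hpi := Real.pi_gt_three
  have hs : 0 < √(2 * Real.pi) := by positivity
  have e1 : √(Real.pi / 2) * 2 = √(2 * Real.pi) := by
    rw [show 2 * Real.pi = Real.pi / 2 * 2 ^ 2 by ring, Real.sqrt_mul (by positivity),
      Real.sqrt_sq (by norm_num)]
  set e := ε / √(2 * Real.pi) with he
  have he0 : 0 < e := by positivity
  have h1 : (2 * a - 1) * e ≤ 1 - a := by
    have := mul_le_mul_of_nonneg_right h he0.le
    have e2 : √(Real.pi / 2) * (2 / ε * (1 - a)) * e = 1 - a := by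
      calc _ = (√(Real.pi / 2) * 2) * (1 - a) / √(2 * Real.pi) := by rw [he]; field_simp
        _ = 1 - a := by rw [e1]; field_simp
    linarith
  have hlog : Real.log 2 ≤ Real.log m :=
    Real.log_le_log (by norm_num) (by exact_mod_cast hm)
  have hl2 := Real.log_two_gt_d9
  have h1l : 1 ≤ √(2 * Real.log m) := Real.one_le_sqrt.2 (by linarith)
  have h2s : 2 ≤ √(2 * Real.pi) := Real.le_sqrt_of_sq_le (by nlinarith)
  have h2e : 2 * e ≤ ε * √(2 * Real.log m) := by
    have : 2 * e ≤ ε := by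
      rw [he]
      rw [mul_div_assoc', div_le_iff₀ hs]
      nlinarith
    nlinarith
  have e3 : ε * (1 - ε * √(2 * Real.log (m : ℝ))) / √(2 * Real.pi) =
      e * (1 - ε * √(2 * Real.log (m : ℝ))) := by rw [he]; ring
  rw [e3]
  set t := ε * √(2 * Real.log (m : ℝ))
  have ht : 0 ≤ t := by positivity
  -- If `e ≤ 1 - a`, the claim holds as `t ≥ 0`. Otherwise `1 - a ≥ e - 2 e (1 - a) ≥ e - 2 e ^ 2 ≥
  -- e (1 - t)`, using `2 e ≤ t`.
  rcases le_total e (1 - a) with hb | hb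
  · nlinarith
  · nlinarith

lemma le_one_sub_min_of_isoperimetry {m : ℕ} (hm : 2 ≤ m) {a ε : ℝ} (hε : 0 < ε)
    (h : 2 * a - 1 ≤ √(Real.pi / 2) * (2 / ε * (1 - a))) (ha : a ≤ 1)
    (hk : ∀ k, 16 ^ (2 ^ k) ≤ m → 2 * a - 1 ≤
      Real.arccos (Real.exp (-(Real.log 2 / 2 ^ k))) * √(2 / Real.pi) * (2 / ε * (1 - a))) :
    a ≤ 1 - 1 / 20 * min 1 (ε * √(Real.log (m : ℝ))) := by
  rcases le_or_gt a (3 / 4) with h34 | h34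
  · linarith [min_le_left 1 (ε * √(Real.log (m : ℝ)))]
  suffices ε * √(Real.log (m : ℝ)) ≤ 20 * (1 - a) by
    linarith [min_le_right 1 (ε * √(Real.log (m : ℝ)))]
  have hpi := Real.pi_gt_three
  have hpi' := Real.pi_lt_d2
  have hl2 := Real.log_two_gt_d9
  have hl2' := Real.log_two_lt_d9
  have hm0 : (0 : ℝ) < m := by positivity
  have hlogm : 0 ≤ Real.log m := Real.log_natCast_nonneg m
  have hb : 0 ≤ 1 - a := by linarith
  -- Since `a > 3 / 4`, the left side `2 a - 1` exceeds `1 / 2`.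
  have clear : ∀ C : ℝ, 2 * a - 1 ≤ C * (2 / ε * (1 - a)) → ε ≤ 4 * C * (1 - a) := by
    intro C hC
    have h1 : 1 / 2 * ε ≤ C * (2 / ε * (1 - a)) * ε :=
      mul_le_mul_of_nonneg_right (by linarith) hε.le
    have h2 : C * (2 / ε * (1 - a)) * ε = 2 * C * (1 - a) := by field_simp
    linarith
  rcases lt_or_ge m 16 with h16 | h16
  · have hlog : Real.log m ≤ 2 ^ 2 := by
      have : Real.log m ≤ Real.log (2 ^ 4) :=
        Real.log_le_log hm0 (by norm_num; exact_mod_cast h16.le)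
      rw [Real.log_pow] at this
      push_cast at this
      linarith
    have hsl : √(Real.log m) ≤ 2 := Real.sqrt_le_iff.2 ⟨by norm_num, hlog⟩
    have hsp : √(Real.pi / 2) ≤ 2 := Real.sqrt_le_iff.2 ⟨by norm_num, by linarith⟩
    have h1 := clear _ h
    have h2 : ε ≤ 4 * 2 * (1 - a) := h1.trans (by gcongr)
    nlinarith [Real.sqrt_nonneg (Real.log m)]
  · obtain ⟨k, hk1, hk2⟩ := exists_pow_two_pow_le h16
    have h1 := clear _ (hk k hk1)
    set θ := Real.arccos (Real.exp (-(Real.log 2 / 2 ^ k)))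
    have hθ0 : 0 ≤ θ := Real.arccos_nonneg _
    have hθ : θ ^ 2 ≤ Real.pi ^ 2 / 2 * (Real.log 2 / 2 ^ k) :=
      arccos_exp_sq_le _ (by positivity)
    have hlog : Real.log m ≤ 8 * Real.log 2 * 2 ^ k := by
      have : Real.log m ≤ Real.log (2 ^ (4 * 2 ^ (k + 1))) := by
        refine Real.log_le_log hm0 ?_
        rw [pow_mul]
        norm_num
        exact_mod_cast hk2.le
      rw [Real.log_pow] at this
      push_cast at this
      rw [pow_succ] at this
      linarith
    -- The factors `2 ^ k` cancel: the angle is of order `1 / √(log m)`. The bound `5` here, times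
    -- the `4` from `clear`, produces the constant `20`.
    have hprod : (θ * √(Real.log m)) ^ 2 ≤ 5 ^ 2 := by
      rw [mul_pow, Real.sq_sqrt hlogm]
      calc θ ^ 2 * Real.log m
          ≤ Real.pi ^ 2 / 2 * (Real.log 2 / 2 ^ k) * (8 * Real.log 2 * 2 ^ k) := by gcongr
        _ = 4 * (Real.pi * Real.log 2) ^ 2 := by field_simp; ring
        _ ≤ 4 * (3.15 * 0.7) ^ 2 := by gcongr; linarith
        _ ≤ 5 ^ 2 := by norm_num
    have hprod' : θ * √(Real.log m) ≤ 5 := le_of_sq_le_sq hprod (by norm_num)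
    have hsp : √(2 / Real.pi) ≤ 1 := by
      rw [Real.sqrt_le_one, div_le_one (by positivity)]
      linarith
    have hsl := Real.sqrt_nonneg (Real.log m)
    have h2 : ε ≤ 4 * (θ * 1) * (1 - a) := h1.trans (by gcongr)
    calc ε * √(Real.log m) ≤ 4 * (θ * 1) * (1 - a) * √(Real.log m) := by gcongr
      _ = 4 * (1 - a) * (θ * √(Real.log m)) := by ring
      _ ≤ 4 * (1 - a) * 5 := by gcongr
      _ = 20 * (1 - a) := by ring

/-! ### Distances between modes, and bumps seen through the generator. -/

lemma epsMin_nonneg {D m : ℕ} (M : Fin m → Set (EuclideanSpace ℝ (Fin D))) (L : ℝ≥0) :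
    0 ≤ epsMin M L :=
  Real.iInf_nonneg fun _ => div_nonneg (Real.iInf_nonneg fun _ => dist_nonneg) L.2

/-- For `L = 0` every quotient is `0` by the convention on division by zero, so `epsMin` vanishes.
-/
lemma pos_of_epsMin_pos {D m : ℕ} {M : Fin m → Set (EuclideanSpace ℝ (Fin D))} {L : ℝ≥0}
    (h : 0 < epsMin M L) : 0 < (L : ℝ) := by
  rcases L.2.eq_or_lt with h0 | h0
  · have h1 : epsMin M L ≤ 0 := Real.iInf_nonpos fun _ => by
      rw [show (L : ℝ) = 0 from h0.symm, div_zero]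
    linarith
  · exact h0

lemma epsMin_mul_le_dist {D m : ℕ} {M : Fin m → Set (EuclideanSpace ℝ (Fin D))} {L : ℝ≥0}
    (hL : 0 < (L : ℝ)) {i j : Fin m} (hij : i ≠ j) {x y : EuclideanSpace ℝ (Fin D)}
    (hx : x ∈ M i) (hy : y ∈ M j) : epsMin M L * L ≤ dist x y := by
  have h1 : epsMin M L ≤ setDist (M i) (M j) / L :=
    ciInf_le (Set.finite_range _).bddBelow
      (⟨(i, j), hij⟩ : {p : Fin m × Fin m // p.1 ≠ p.2})
  have h2 : setDist (M i) (M j) ≤ dist x y :=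
    ciInf_le (f := fun p : M i × M j => dist (p.1 : EuclideanSpace ℝ (Fin D)) p.2)
      ⟨0, by rintro _ ⟨p, rfl⟩; exact dist_nonneg⟩ (⟨x, hx⟩, ⟨y, hy⟩)
  exact ((le_div_iff₀ hL).1 h1).trans h2

lemma support_empiricalMeasure_subset {D n : ℕ} {X : Fin n → EuclideanSpace ℝ (Fin D)}
    {S : Set (EuclideanSpace ℝ (Fin D))} (hS : IsClosed S) (hX : ∀ k, X k ∈ S) :
    (empiricalMeasure X).support ⊆ S := by
  refine Measure.support_subset_of_isClosed hS ?_
  rw [mem_ae_iff, empiricalMeasure, Measure.smul_apply, Measure.finsetSum_apply]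
  simp [Measure.dirac_apply' _ hS.measurableSet.compl, hX]

/-- A bump around the `i`-th mode, seen through the generator `G`: it equals `1` exactly when `G z`
is in the closure of `N` and vanishes when `G z` is at distance at least `r` from `N`. -/
noncomputable def modeBump {d D : ℕ} (G : EuclideanSpace ℝ (Fin d) → EuclideanSpace ℝ (Fin D))
    (N : Set (EuclideanSpace ℝ (Fin D))) (r : ℝ) (z : EuclideanSpace ℝ (Fin d)) : ℝ :=
  max 0 (1 - Metric.infDist (G z) N / r)

section Bump

variable {d D : ℕ} {G : EuclideanSpace ℝ (Fin d) → EuclideanSpace ℝ (Fin D)}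
  {N : Set (EuclideanSpace ℝ (Fin D))} {r : ℝ}

lemma modeBump_mem_unitInterval (hr : 0 < r) (z : EuclideanSpace ℝ (Fin d)) :
    modeBump G N r z ∈ Set.Icc (0 : ℝ) 1 := by
  refine ⟨le_max_left _ _, max_le zero_le_one ?_⟩
  have : 0 ≤ Metric.infDist (G z) N / r := div_nonneg Metric.infDist_nonneg hr.le
  linarith

lemma lipschitzWith_modeBump {L K : ℝ≥0} (hG : LipschitzWith L G) (hr : 0 < r)
    (hK : (K : ℝ) = L / r) : LipschitzWith K (modeBump G N r) := by
  refine LipschitzWith.of_dist_le_mul fun x y => ?_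
  rw [Real.dist_eq, modeBump, modeBump, max_comm 0, max_comm 0]
  refine (abs_max_sub_max_le_abs _ _ 0).trans ?_
  have h1 : |Metric.infDist (G y) N - Metric.infDist (G x) N| ≤ L * dist x y := by
    rw [← Real.dist_eq, dist_comm x y]
    refine ((Metric.lipschitz_infDist_pt N).dist_le_mul _ _).trans ?_
    rw [NNReal.coe_one, one_mul]
    exact hG.dist_le_mul _ _
  have h2 : 1 - Metric.infDist (G x) N / r - (1 - Metric.infDist (G y) N / r) =
      (Metric.infDist (G y) N - Metric.infDist (G x) N) / r := by ring
  rw [h2, abs_div, abs_of_pos hr, hK, div_mul_eq_mul_div]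
  exact div_le_div_of_nonneg_right h1 hr.le

lemma infDist_lt_of_modeBump_pos (hr : 0 < r) {z : EuclideanSpace ℝ (Fin d)}
    (h : 0 < modeBump G N r z) : Metric.infDist (G z) N < r := by
  rcases lt_max_iff.1 h with h | h
  · exact absurd h (lt_irrefl _)
  · rw [sub_pos, div_lt_one hr] at h
    exact h

lemma modeBump_eq_one {z : EuclideanSpace ℝ (Fin d)} (h : G z ∈ N) : modeBump G N r z = 1 := by
  rw [modeBump, Metric.infDist_zero_of_mem h]
  simp

end Bump

/-- A point in the support of the `i`-th bump and in a cell `A j` with `j ≠ i` would be sent closer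
than half the minimal gap to both `M i` and `M j`, contradicting the triangle inequality. Hence the
support lies in `A i` up to a null set. -/
lemma measureReal_modeBump_pos_le {d D m : ℕ} {M : Fin m → Set (EuclideanSpace ℝ (Fin D))}
    (hM : ∀ i, (M i).Nonempty) {L : ℝ≥0} (hε : 0 < epsMin M L)
    {G : EuclideanSpace ℝ (Fin d) → EuclideanSpace ℝ (Fin D)} (hG : IsWellBalanced M G)
    (i : Fin m) :
    (stdGaussian (EuclideanSpace ℝ (Fin d))).real
      {z | 0 < modeBump G (M i) (epsMin M L * L / 2) z} ≤ 1 / (m : ℝ) := by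
  obtain ⟨A, hA, hAG, hAm⟩ := hG
  have hL := pos_of_epsMin_pos hε
  have hr : 0 < epsMin M L * L / 2 := by positivity
  rw [← hAm i]
  refine ENNReal.toReal_mono (measure_ne_top _ _) (measure_mono_ae ?_)
  filter_upwards [hA.cover] with z hz hzU
  obtain ⟨j, hj⟩ := Set.mem_iUnion.1 hz
  by_cases hij : i = j
  · rw [hij]; exact hj
  · exfalso
    have h1 := infDist_lt_of_modeBump_pos hr hzU
    have h2 := (hAG j z hj i).trans_lt h1
    obtain ⟨x, hx, hzx⟩ := (Metric.infDist_lt_iff (hM i)).1 h1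
    obtain ⟨y, hy, hzy⟩ := (Metric.infDist_lt_iff (hM j)).1 h2
    have h3 := epsMin_mul_le_dist hL hij hx hy
    have h4 := dist_triangle_left x y (G z)
    linarith

lemma genPrecision_le_sum {d D m : ℕ} {M : Fin m → Set (EuclideanSpace ℝ (Fin D))}
    {ν : Measure (EuclideanSpace ℝ (Fin D))} (hν : ν.support ⊆ ⋃ i, M i)
    {G : EuclideanSpace ℝ (Fin d) → EuclideanSpace ℝ (Fin D)} (hG : Measurable G) (r : ℝ) :
    genPrecision ν G ≤
      ∑ i, (stdGaussian (EuclideanSpace ℝ (Fin d))).real {z | modeBump G (M i) r z = 1} := by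
  rw [genPrecision, map_measureReal_apply hG Measure.isClosed_support.measurableSet]
  refine (measureReal_mono ?_ (measure_ne_top _ _)).trans (measureReal_iUnion_fintype_le _)
  intro z hz
  obtain ⟨i, hi⟩ := Set.mem_iUnion.1 (hν hz)
  exact Set.mem_iUnion.2 ⟨i, modeBump_eq_one hi⟩

lemma genPrecision_le_one {d D : ℕ} (ν : Measure (EuclideanSpace ℝ (Fin D)))
    {G : EuclideanSpace ℝ (Fin d) → EuclideanSpace ℝ (Fin D)} (hG : Measurable G) :
    genPrecision ν G ≤ 1 := by
  have := Measure.isProbabilityMeasure_map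
    (μ := stdGaussian (EuclideanSpace ℝ (Fin d))) hG.aemeasurable
  exact measureReal_le_one

/-! ### The bounds on the precision. -/

/-- The universal constant `c` gives the rate `√(log m)`; the two kinds of `ν` are the target
distribution itself and the empirical measure of a sample from its support. -/
theorem corollary1 :
    ∃ c : ℝ, 0 < c ∧
      ∀ (d D m : ℕ) (μ : Measure (EuclideanSpace ℝ (Fin D))) (_ : IsProbabilityMeasure μ)
        (M : Fin m → Set (EuclideanSpace ℝ (Fin D))) (_ : HasDisconnectedModes μ M)
        (L : ℝ≥0) (_ : (d : ℝ) * √(Real.log (m : ℝ)) ≤ (L : ℝ))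
        (G : EuclideanSpace ℝ (Fin d) → EuclideanSpace ℝ (Fin D)) (_ : LipschitzWith L G)
        (_ : IsWellBalanced M G)
        (ν : Measure (EuclideanSpace ℝ (Fin D)))
        (_ : ν = μ ∨ ∃ n : ℕ, 0 < n ∧ ∃ X : Fin n → EuclideanSpace ℝ (Fin D),
          (∀ k, X k ∈ μ.support) ∧ ν = empiricalMeasure X)
        (_ : genRecall ν G = 1),
        genPrecision ν G ≤
            1 - epsMin M L * (1 - epsMin M L * √(2 * Real.log (m : ℝ))) / √(2 * Real.pi) ∧
          genPrecision ν G ≤ 1 - c * min 1 (epsMin M L * √(Real.log (m : ℝ))) := by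
  refine ⟨1 / 20, by norm_num, ?_⟩
  intro d D m μ _ M hM L _ G hG hbal ν hν _
  have hGm : Measurable G := hG.continuous.measurable
  have hsupp : ν.support ⊆ ⋃ i, M i := by
    rw [← hM.support_eq]
    rcases hν with rfl | ⟨n, -, X, hX, rfl⟩
    · exact subset_rfl
    · exact support_empiricalMeasure_subset Measure.isClosed_support hX
  have hone := genPrecision_le_one (d := d) ν hGm
  -- If `epsMin` vanishes (modes may be at distance zero without meeting), both bounds reduce to
  -- precision at most `1`.
  rcases (epsMin_nonneg M L).eq_or_lt with h0 | hε
  · rw [← h0]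
    simpa using hone
  have hL := pos_of_epsMin_pos hε
  set ε := epsMin M L
  set r : ℝ := ε * L / 2
  have hr : 0 < r := by positivity
  let K : ℝ≥0 := ⟨2 / ε, by positivity⟩
  have hK : (K : ℝ) = L / r := by
    change 2 / ε = L / (ε * L / 2)
    field_simp
  have hf : ∀ i, LipschitzWith K (modeBump G (M i) r) := fun i => lipschitzWith_modeBump hG hr hK
  have hf' : ∀ i z, modeBump G (M i) r z ∈ Set.Icc (0 : ℝ) 1 := fun i =>
    modeBump_mem_unitInterval hr
  have hU := measureReal_modeBump_pos_le hM.nonempty hε hbal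
  set a := ∑ i, (stdGaussian (EuclideanSpace ℝ (Fin d))).real {z | modeBump G (M i) r z = 1}
    with ha
  have hle : genPrecision ν G ≤ a := genPrecision_le_sum hsupp hGm r
  have ha1 : a ≤ 1 := by
    have hm0 : (m : ℝ) ≠ 0 := by have := hM.two_le; positivity
    calc a ≤ ∑ _i : Fin m, 1 / (m : ℝ) := Finset.sum_le_sum fun i _ =>
          (measureReal_mono (fun z (hz : _ = _) => by
            change 0 < modeBump G (M i) r z
            rw [hz]; exact one_pos) (measure_ne_top _ _)).trans (hU i)
      _ = 1 := by simp [hm0]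
  have hiso := two_mul_sum_sub_one_le hf hf' hM.two_le hU
  exact ⟨hle.trans (le_one_sub_mul_of_isoperimetry hM.two_le hε hiso),
    hle.trans (le_one_sub_min_of_isoperimetry hM.two_le hε hiso ha1 fun k hk =>
      two_mul_sum_sub_one_le_arccos hf hf' hk hU)⟩
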